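/- Let $\nu>-1$, let $\rho_\nu(x)=2x^{\nu/2}K_\nu(2\sqrt x)$ for $x>0$, where $K_\nu$ is the modified Bessel function of the second kind, and let $\Psi(a,b;z)$ be Tricomi's confluent hypergeometric function, $\Psi(a,b;z)=\frac1{\Gamma(a)}\int_0^\infty e^{-zt}t^{a-1}(1+t)^{b-a-1}\,dt$ for $a,z>0$. For $k,m\ge 0$ put $$d_{k,m}=\Gamma(1+\nu)\sum_{r=0}^k(-1)^{k+r}\binom kr\frac{(1+\nu)_k}{(1+\nu)_r}\,\Gamma(1+\nu+k+r+m)\,\Psi(1+m,\,1-\nu-k-r;\,1),$$ where $(a)_k=a(a+1)\cdots(a+k-1)$. For $n\ge 0$ let $D_n=\det(d_{j,i})_{0\le i\le n-1,\;1\le j\le n}$ ($i$ is the row index, $j$ the column index, and $D_0=1$); for $1\le k\le n$ let $D_{n,k}$ be the determinant obtained from $D_n$ by replacing the column $(d_{k,i})_{0\le i\le n-1}$ by $(d_{0,i})_{0\le i\le n-1}$; let $D_{n,0}=-D_n$ and $D_{0,-1}=0$. Put $$S_n=\sum_{k=0}^nD_{n,k}\,(n+k)!\,d_{0,n+k}.$$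 Then all polynomials are integrable against the weight $e^{-x}\rho_\nu(x)$ on $(0,\infty)$; $D_n\ne0$, $D_{n,n}\neq0$ and $D_{n,n}S_n>0$ for all $n\ge0$; and there is exactly one sequence of real polynomials $P_n^\nu$ with $\deg P_n^\nu=n$ and positive leading coefficients such that $\int_0^\infty P_m^\nu(x)P_n^\nu(x)e^{-x}\rho_\nu(x)\,dx=\delta_{m,n}$ for all $m,n\ge0$. Moreover, let $P_n^\nu(x)=\sum_{k=0}^na_{n,k}x^k$, $n\ge 0$, be any sequence of real polynomials with $\deg P_n^\nu=n$ that is orthonormal in this sense (with leading coefficients of any sign). Then the following hold. 1. $a_{n,k}=-a_{n,0}\,D_{n,k}/D_n$ for $1\le k\le n$. 2. $a_{n,0}=\pm D_n\left[\dfrac{\Gamma(1+\nu)}{D_{n,n}S_n}\right]^{1/2}\ne 0$, where the sign $\pm$ is $(-1)^n$ if $a_{n,n}>0$. 3. With $P_{-1}^\nu=0$, for every $n\ge0$, $$xP_n^\nu(x)=A_{n+1}P_{n+1}^\nu(x)+B_nP_n^\nu(x)+A_nP_{n-1}^\nu(x),$$ $$A_{n+1}=\frac{a_{n,0}\,D_{n+1}\,D_{n,n}}{a_{n+1,0}\,D_n\,D_{n+1,n+1}},\qquad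 B_n=\frac{D_{n,n-1}}{D_{n,n}}-\frac{D_{n+1,n}}{D_{n+1,n+1}}.$$ -/

import Mathlib

open Polynomial MeasureTheory Set

noncomputable section

namespace PrudnikovType

/-- The modified Bessel function of the second kind `K_ν(z)` for real `ν` and `z > 0`, by its
standard integral representation `K_ν(z) = ∫_0^∞ e^{-z cosh u} cosh (ν u) du`
(which converges absolutely for every real `ν` and `z > 0`). -/
def besselK (ν z : ℝ) : ℝ :=
  ∫ u in Ioi (0 : ℝ), Real.exp (-z * Real.cosh u) * Real.cosh (ν * u)

/-- `ρ_ν(x) = 2 x^{ν/2} K_ν(2 √x)`, for `x > 0`. -/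
def rho (ν x : ℝ) : ℝ :=
  2 * x ^ (ν / 2) * besselK ν (2 * Real.sqrt x)

/-- The weight `e^{-x} ρ_ν(x)` on `(0, ∞)`. -/
def weight (ν x : ℝ) : ℝ :=
  Real.exp (-x) * rho ν x

/-- Tricomi's confluent hypergeometric function `Ψ(a, b; z)` for real `a > 0`, `z > 0` and
real `b`: `Ψ(a, b; z) = Γ(a)⁻¹ ∫_0^∞ e^{-z t} t^{a-1} (1+t)^{b-a-1} dt`.  It is used below only
with `a ≥ 1` and `z = 1`. -/
def tricomiPsi (a b z : ℝ) : ℝ :=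
  (Real.Gamma a)⁻¹ *
    ∫ t in Ioi (0 : ℝ), Real.exp (-z * t) * t ^ (a - 1) * (1 + t) ^ (b - a - 1)

/-- The Pochhammer symbol `(a)_k = a (a+1) ⋯ (a+k-1)`. -/
def poch (a : ℝ) (k : ℕ) : ℝ := (ascPochhammer ℝ k).eval a

/-- `d_{k,m} = Γ(1+ν) ∑_{r=0}^k (-1)^{k+r} C(k,r) (1+ν)_k / (1+ν)_r · Γ(1+ν+k+r+m)
  · Ψ(1+m, 1-ν-k-r; 1)`. -/
def dCoeff (ν : ℝ) (k m : ℕ) : ℝ :=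
  Real.Gamma (1 + ν) * ∑ r ∈ Finset.range (k + 1),
    (-1 : ℝ) ^ (k + r) * (k.choose r : ℝ) * (poch (1 + ν) k / poch (1 + ν) r) *
      Real.Gamma (1 + ν + k + r + m) * tricomiPsi (1 + m) (1 - ν - k - r) 1

/-- `D_n = det (d_{j,i})` with rows `i = 0, …, n-1` and columns `j = 1, …, n`; `D_0 = 1`. -/
def D (ν : ℝ) (n : ℕ) : ℝ :=
  Matrix.det (Matrix.of fun i j : Fin n => dCoeff ν ((j : ℕ) + 1) (i : ℕ))

/-- `D_{n,k}` for `0 ≤ k ≤ n`: for `1 ≤ k ≤ n` the determinant `D_n` with the column of the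
`d_{k,i}` replaced by the column of the `d_{0,i}`, and `D_{n,0} = -D_n`. -/
def DRepl (ν : ℝ) (n k : ℕ) : ℝ :=
  if k = 0 then -D ν n
  else Matrix.det (Matrix.of fun i j : Fin n =>
    if (j : ℕ) + 1 = k then dCoeff ν 0 (i : ℕ) else dCoeff ν ((j : ℕ) + 1) (i : ℕ))

/-- `D_{n,n-1}`, with the convention that it is `0` for `n = 0`
(there is no coefficient of index `-1`). -/
def DSub (ν : ℝ) : ℕ → ℝ
  | 0 => 0
  | n + 1 => DRepl ν (n + 1) n

/-- `∑_{k=0}^n D_{n,k} (n+k)! d_{0,n+k}`. -/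
def normSum (ν : ℝ) (n : ℕ) : ℝ :=
  ∑ k ∈ Finset.range (n + 1), DRepl ν n k * ((n + k).factorial : ℝ) * dCoeff ν 0 (n + k)

/-- `P 0, P 1, …` is a sequence of orthonormal polynomials for the weight `e^{-x} ρ_ν(x)` on
`(0, ∞)`, with `P n` of exact degree `n`. -/
structure IsOrthonormalSeq (ν : ℝ) (P : ℕ → ℝ[X]) : Prop where
  natDegree_eq : ∀ n, (P n).natDegree = n
  integral_eq : ∀ m n,
    ∫ x in Ioi (0 : ℝ), (P m).eval x * (P n).eval x * weight ν x = if m = n then 1 else 0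

end PrudnikovType

end

/-!
The proof rests on one identity: the coefficients `d_{k,m}` are moments in disguise,
`m! d_{k,m} = Γ(1+ν) μ_{k+m}` with `μ_n = ∫_0^∞ x^n e^{-x} ρ_ν(x) dx`
(`factorial_mul_dCoeff_eq_moment`). After the substitution `t = √x e^u` in the integral of the
Bessel function, `ρ_ν(x) = ∫_0^∞ t^{ν-1} e^{-t-x/t} dt` (`rho_eq_integral`), and Tonelli's theorem
gives `μ_n = n! ∫_0^∞ t^{ν+n} e^{-t} (1+t)^{-n-1} dt` (`weight_moment`). On the other side, each
product `Γ(1+ν+k+r+m) Ψ(1+m, 1-ν-k-r; 1)` is an integral of the same kind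
(`gamma_mul_tricomiPsi`), and the alternating sum over `r` is an integral of
`t^ν e^{-t} k! L_k^ν(t)`, with the Laguerre polynomial `L_k^ν`, against
`t^{k+m} (1+t)^{-m-1}`; by the Rodrigues formula, `k` integrations by parts collapse it
(`sum_laguerreCoeff_mul_kummerInt`).

The rest is the classical theory of orthogonal polynomials. The weight is positive, so
`D_n ≠ 0`, since a kernel vector would be a polynomial `q` with `∫ x q(x)² e^{-x} ρ_ν(x) dx = 0`
(`D_ne_zero`). By Cramer's rule the polynomial `Q_n = ∑_k D_{n,k} x^k` (`detPoly`) is orthogonal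
to all polynomials of lower degree, and its squared norm is `D_{n,n} S_n / Γ(1+ν)`
(`DRepl_mul_normSum`). Moving the last column to the front turns `D_{n,n}` into a positive multiple
of `(-1)^{n-1}` times a Hankel determinant of moments, which fixes its sign
(`neg_one_pow_mul_DRepl_neg`). Any orthonormal sequence consists of the multiples
`±(Γ(1+ν) / (D_{n,n} S_n))^{1/2} Q_n`, and the coefficients of the three-term recurrence are read
off from the two leading coefficients (`three_term_recurrence`).
-/

noncomputable section

namespace PrudnikovType

/-! ### Exchanging two integrations over the half-line -/

/-- Tonelli's theorem for a nonnegative continuous kernel on the open quadrant: the iterated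
integral is controlled by integrating first in the variable in which the inner integral `g` is
known in closed form. -/
theorem integrableOn_and_integral_swap {F : ℝ → ℝ → ℝ} {g : ℝ → ℝ}
    (hF : ContinuousOn (Function.uncurry F) (Ioi 0 ×ˢ Ioi 0))
    (h0 : ∀ x > 0, ∀ t > 0, 0 ≤ F x t)
    (hi : ∀ t > 0, IntegrableOn (fun x => F x t) (Ioi 0))
    (hg : ∀ t > 0, ∫ x in Ioi (0 : ℝ), F x t = g t)
    (hgi : IntegrableOn g (Ioi 0)) :
    IntegrableOn (fun x => ∫ t in Ioi (0 : ℝ), F x t) (Ioi 0) ∧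
      ∫ x in Ioi (0 : ℝ), ∫ t in Ioi (0 : ℝ), F x t = ∫ t in Ioi (0 : ℝ), g t := by
  have hae : ∀ᵐ t ∂(volume.restrict (Ioi (0 : ℝ))), 0 < t := ae_restrict_mem measurableSet_Ioi
  have hmeas : AEStronglyMeasurable (Function.uncurry F)
      ((volume.restrict (Ioi (0 : ℝ))).prod (volume.restrict (Ioi (0 : ℝ)))) := by
    rw [Measure.prod_restrict]
    exact hF.aestronglyMeasurable (measurableSet_Ioi.prod measurableSet_Ioi)
  have hint : Integrable (Function.uncurry F)
      ((volume.restrict (Ioi (0 : ℝ))).prod (volume.restrict (Ioi (0 : ℝ)))) := by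
    rw [integrable_prod_iff' hmeas]
    constructor
    · filter_upwards [hae] with t ht
      exact hi t ht
    · refine Integrable.congr hgi ?_
      filter_upwards [hae] with t ht
      rw [← hg t ht]
      refine setIntegral_congr_fun measurableSet_Ioi fun x hx => ?_
      exact (Real.norm_of_nonneg (h0 x hx t ht)).symm
  refine ⟨hint.integral_prod_left, ?_⟩
  rw [integral_integral_swap hint]
  exact setIntegral_congr_fun measurableSet_Ioi fun t ht => hg t ht

theorem integrableOn_rpow_mul_exp_neg_mul {a r : ℝ} (ha : -1 < a) (hr : 0 < r) :
    IntegrableOn (fun t : ℝ => t ^ a * Real.exp (-(r * t))) (Ioi 0) := by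
  have := integrableOn_rpow_mul_exp_neg_mul_rpow ha one_pos hr
  simpa [neg_mul] using this

theorem integral_pow_mul_exp_neg_mul (n : ℕ) {r : ℝ} (hr : 0 < r) :
    ∫ t in Ioi (0 : ℝ), t ^ n * Real.exp (-(r * t)) = n.factorial / r ^ (n + 1) := by
  have h := Real.integral_rpow_mul_exp_neg_mul_Ioi (a := (n : ℝ) + 1) (by positivity) hr
  rw [Real.Gamma_nat_eq_factorial] at h
  simp only [add_sub_cancel_right, Real.rpow_natCast] at h
  rw [h, show ((n : ℝ) + 1) = ((n + 1 : ℕ) : ℝ) by push_cast; ring, Real.rpow_natCast,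
    one_div, inv_pow, inv_mul_eq_div]

theorem integrableOn_pow_mul_exp_neg_mul (n : ℕ) {r : ℝ} (hr : 0 < r) :
    IntegrableOn (fun t : ℝ => t ^ n * Real.exp (-(r * t))) (Ioi 0) := by
  have h := integrableOn_rpow_mul_exp_neg_mul (a := n)
    (by have := n.cast_nonneg (α := ℝ); linarith) hr
  simpa using h

/-! ### The integrals `∫ t ^ a e ^ (-t) (1 + t) ^ (-j) dt` -/

/-- The integral `∫_0^∞ t ^ a e^{-t} (1 + t)^{-j} dt`, convergent for `a > -1`. Up to a Gamma
factor it is a value of Tricomi's function at `1`. -/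
def kummerInt (a : ℝ) (j : ℕ) : ℝ :=
  ∫ t in Ioi (0 : ℝ), t ^ a * Real.exp (-t) / (1 + t) ^ j

theorem integrableOn_kummerInt {a : ℝ} (ha : -1 < a) (j : ℕ) :
    IntegrableOn (fun t : ℝ => t ^ a * Real.exp (-t) / (1 + t) ^ j) (Ioi 0) := by
  have h := integrableOn_rpow_mul_exp_neg_mul ha one_pos
  simp only [one_mul] at h
  refine Integrable.mono' h ?_ ?_
  · refine ContinuousOn.aestronglyMeasurable (fun t ht => ?_) measurableSet_Ioi
    have ht : (0 : ℝ) < t := ht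
    have h1 : (1 + t) ^ j ≠ 0 := by positivity
    refine ContinuousAt.continuousWithinAt ?_
    have : ContinuousAt (fun t : ℝ => t ^ a) t := Real.continuousAt_rpow_const _ _ (Or.inl ht.ne')
    fun_prop (disch := assumption)
  · filter_upwards [ae_restrict_mem measurableSet_Ioi] with t ht
    have ht : (0 : ℝ) < t := ht
    rw [Real.norm_of_nonneg (by positivity)]
    exact div_le_self (by positivity) (one_le_pow₀ (by linarith))

/-- Splitting `1 + t` in the numerator. -/
theorem kummerInt_eq_add {a : ℝ} (ha : -1 < a) (j : ℕ) :
    kummerInt a j = kummerInt a (j + 1) + kummerInt (a + 1) (j + 1) := by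
  unfold kummerInt
  rw [← integral_add (integrableOn_kummerInt ha _) (integrableOn_kummerInt (by linarith) _)]
  refine setIntegral_congr_fun measurableSet_Ioi fun t ht => ?_
  have ht : (0 : ℝ) < t := ht
  have h1 : (1 + t) ≠ 0 := by positivity
  simp only [Real.rpow_add_one ht.ne']
  field_simp
  ring

/-- Integration by parts: the integral of the derivative of `t ^ (a + 1) e ^ (-t) (1 + t) ^ (-j)`
vanishes. -/
theorem kummerInt_by_parts {a : ℝ} (ha : -1 < a) (j : ℕ) :
    (a + 1) * kummerInt a j - kummerInt (a + 1) j - j * kummerInt (a + 1) (j + 1) = 0 := by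
  have i1 := (integrableOn_kummerInt ha j).const_mul (a + 1)
  have i2 := integrableOn_kummerInt (a := a + 1) (by linarith) j
  have i3 := (integrableOn_kummerInt (a := a + 1) (by linarith) (j + 1)).const_mul (j : ℝ)
  unfold kummerInt
  rw [← integral_const_mul, ← integral_const_mul, ← integral_sub i1 i2,
    ← integral_sub (by exact i1.sub i2) i3]
  have key := integral_Ioi_of_hasDerivAt_of_tendsto (a := 0) (m := 0)
    (f := fun t : ℝ => t ^ (a + 1) * Real.exp (-t) / (1 + t) ^ j)
    (f' := fun t => (a + 1) * (t ^ a * Real.exp (-t) / (1 + t) ^ j) -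
      t ^ (a + 1) * Real.exp (-t) / (1 + t) ^ j -
      j * (t ^ (a + 1) * Real.exp (-t) / (1 + t) ^ (j + 1))) ?_ ?_ ((i1.sub i2).sub i3) ?_
  · refine key.trans ?_
    simp [Real.zero_rpow (by linarith : a + 1 ≠ 0)]
  · refine ContinuousAt.continuousWithinAt ?_
    have h : ContinuousAt (fun t : ℝ => t ^ (a + 1)) 0 :=
      Real.continuousAt_rpow_const _ _ (Or.inr (by linarith))
    have h1 : ((1 : ℝ) + 0) ^ j ≠ 0 := by simp
    fun_prop (disch := assumption)
  · intro t ht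
    have ht : (0 : ℝ) < t := ht
    have h1 : (1 + t) ^ j ≠ 0 := by positivity
    have d1 := Real.hasDerivAt_rpow_const (x := t) (p := a + 1) (Or.inl ht.ne')
    have d2 : HasDerivAt (fun t : ℝ => Real.exp (-t)) (-Real.exp (-t)) t := by
      simpa using (hasDerivAt_neg t).exp
    have d3 : HasDerivAt (fun t : ℝ => (1 + t) ^ j) (j * (1 + t) ^ (j - 1)) t :=
      (((hasDerivAt_id t).const_add 1).pow j).congr_deriv (by simp)
    refine ((d1.mul d2).div d3 h1).congr_deriv ?_
    rw [add_sub_cancel_right]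
    have h2 : 1 + t ≠ 0 := by positivity
    rcases j with _ | j
    · simp; ring
    · simp only [Nat.add_sub_cancel]
      field_simp
      simp only [Pi.mul_apply]
      ring
  · have h := tendsto_rpow_mul_exp_neg_mul_atTop_nhds_zero (a + 1) 1 one_pos
    simp only [neg_mul, one_mul] at h
    refine squeeze_zero' ?_ ?_ h
    · filter_upwards [Filter.eventually_ge_atTop 0] with t ht
      positivity
    · filter_upwards [Filter.eventually_ge_atTop 0] with t ht
      exact div_le_self (by positivity) (one_le_pow₀ (by linarith))

/-- Writing `Γ(1 + a) (1 + t) ^ (-1 - a)` as a Laplace transform and integrating in `t` first. -/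
theorem gamma_mul_tricomiPsi {a : ℝ} (ha : -1 < a) (m : ℕ) :
    Real.Gamma (1 + a) * tricomiPsi (1 + m) (1 + m - a) 1 = kummerInt a (m + 1) := by
  have hsw := (integrableOn_and_integral_swap
    (F := fun t s => t ^ m * Real.exp (-t) * (s ^ a * Real.exp (-((1 + t) * s))))
    (g := fun s => m.factorial * (s ^ a * Real.exp (-s) / (1 + s) ^ (m + 1))) ?_ ?_ ?_ ?_ ?_).2
  · rw [integral_const_mul] at hsw
    have hf : (m.factorial : ℝ) ≠ 0 := by positivity
    have hG : Real.Gamma (1 + (m : ℝ)) = m.factorial := by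
      rw [add_comm, Real.Gamma_nat_eq_factorial]
    unfold tricomiPsi kummerInt
    rw [hG, mul_left_comm, inv_mul_eq_iff_eq_mul₀ hf, ← hsw, ← integral_const_mul]
    refine setIntegral_congr_fun measurableSet_Ioi fun t ht => ?_
    have ht : (0 : ℝ) < t := ht
    have h1 : 0 < 1 + t := by positivity
    have h := Real.integral_rpow_mul_exp_neg_mul_Ioi (a := 1 + a) (by linarith) h1
    simp only [add_sub_cancel_left] at h
    simp only [integral_const_mul, h]
    rw [show (1 + (m : ℝ) - a - (1 + m) - 1) = -(1 + a) by ring, Real.rpow_neg h1.le,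
      one_div, Real.inv_rpow h1.le, add_sub_cancel_left, Real.rpow_natCast]
    ring_nf
  · intro p hp
    obtain ⟨t, s⟩ := p
    have hs : (0 : ℝ) < s := hp.2
    refine ContinuousAt.continuousWithinAt ?_
    have : ContinuousAt (fun p : ℝ × ℝ => p.2 ^ a) (t, s) :=
      ContinuousAt.rpow_const continuousAt_snd (Or.inl hs.ne')
    unfold Function.uncurry
    fun_prop
  · intro t ht s hs
    positivity
  · intro s hs
    have h := (integrableOn_pow_mul_exp_neg_mul m (by positivity : 0 < 1 + s)).const_mul
      (s ^ a * Real.exp (-s))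
    refine IntegrableOn.congr_fun h (fun t _ => ?_) measurableSet_Ioi
    have : Real.exp (-s) * Real.exp (-((1 + s) * t)) =
      Real.exp (-t) * Real.exp (-((1 + t) * s)) := by
      rw [← Real.exp_add, ← Real.exp_add]; ring_nf
    linear_combination (s ^ a * t ^ m) * this
  · intro s hs
    have h := integral_pow_mul_exp_neg_mul m (by positivity : 0 < 1 + s)
    have h2 : ∀ t, t ^ m * Real.exp (-t) * (s ^ a * Real.exp (-((1 + t) * s))) =
        (s ^ a * Real.exp (-s)) * (t ^ m * Real.exp (-((1 + s) * t))) := by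
      intro t
      have : Real.exp (-s) * Real.exp (-((1 + s) * t)) =
        Real.exp (-t) * Real.exp (-((1 + t) * s)) := by
        rw [← Real.exp_add, ← Real.exp_add]; ring_nf
      linear_combination -(s ^ a * t ^ m) * this
    simp only [h2, integral_const_mul, h]
    ring
  · exact (integrableOn_kummerInt ha _).const_mul _

/-! ### The coefficients `d_{k,m}` -/

/-- The coefficients `(-1)^{k+r} C(k,r) (1+ν)_k / (1+ν)_r` of the polynomial
`(-1)^k k! L_k^ν`, where `L_k^ν` is the Laguerre polynomial. -/
def laguerreCoeff (ν : ℝ) (k r : ℕ) : ℝ :=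
  (-1 : ℝ) ^ (k + r) * (k.choose r : ℝ) * (poch (1 + ν) k / poch (1 + ν) r)

theorem poch_pos {a : ℝ} (ha : 0 < a) (k : ℕ) : 0 < poch a k :=
  ascPochhammer_pos k a ha

theorem poch_succ_left (a : ℝ) (k : ℕ) : poch a (k + 1) = a * poch (a + 1) k := by
  unfold poch
  rw [ascPochhammer_succ_left]
  simp [eval_comp]

theorem poch_succ_right (a : ℝ) (k : ℕ) : poch a (k + 1) = poch a k * (a + k) := by
  unfold poch
  rw [ascPochhammer_succ_eval]

/-- The Rodrigues-type relation
`t^ν e^{-t} k! L_k^ν = (t^{ν+1} e^{-t} (k-1)! L_{k-1}^{ν+1})'` on coefficients. -/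
theorem laguerreCoeff_succ_succ {ν : ℝ} (hν : -1 < ν) (k r : ℕ) :
    laguerreCoeff ν (k + 1) (r + 1) =
      laguerreCoeff (ν + 1) k r - (ν + 2 + r) * laguerreCoeff (ν + 1) k (r + 1) := by
  have h1 : (0 : ℝ) < 1 + ν := by linarith
  have h2 : (0 : ℝ) < 1 + ν + 1 := by linarith
  have p := (poch_pos h2 r).ne'
  have h3 : (1 + ν + 1 + r) ≠ 0 := by positivity
  unfold laguerreCoeff
  rw [show 1 + (ν + 1) = 1 + ν + 1 by ring, poch_succ_left (1 + ν) k, poch_succ_left (1 + ν) r,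
    poch_succ_right (1 + ν + 1) r, Nat.choose_succ_succ]
  push_cast
  field_simp
  ring

theorem laguerreCoeff_succ_zero (ν : ℝ) (k : ℕ) :
    laguerreCoeff ν (k + 1) 0 = -((ν + 1) * laguerreCoeff (ν + 1) k 0) := by
  unfold laguerreCoeff
  rw [show 1 + (ν + 1) = 1 + ν + 1 by ring, poch_succ_left (1 + ν) k]
  simp [poch, pow_succ]
  ring

theorem laguerreCoeff_eq_zero {ν : ℝ} {k r : ℕ} (h : k < r) : laguerreCoeff ν k r = 0 := by
  simp [laguerreCoeff, Nat.choose_eq_zero_of_lt h]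

/-- Integrating by parts `k` times against the Laguerre polynomial of degree `k` collapses the
alternating sum to a single integral. -/
theorem sum_laguerreCoeff_mul_kummerInt (k : ℕ) :
    ∀ {ν : ℝ}, -1 < ν → ∀ m : ℕ,
    (m.factorial : ℝ) * ∑ r ∈ Finset.range (k + 1),
      laguerreCoeff ν k r * kummerInt (ν + k + r + m) (m + 1) =
      (k + m).factorial * kummerInt (ν + k + m) (k + m + 1) := by
  induction k with
  | zero =>
    intro ν hν m
    simp [laguerreCoeff, poch]
  | succ k ih =>
    intro ν hν m
    have hν' : -1 < ν + 1 := by linarith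
    have i1 := ih hν' m
    have i2 := ih hν' (m + 1)
    have hsum : ∑ r ∈ Finset.range (k + 1 + 1),
        laguerreCoeff ν (k + 1) r * kummerInt (ν + (k + 1 : ℕ) + r + m) (m + 1) =
        (k + 1 + m) * ∑ r ∈ Finset.range (k + 1),
          laguerreCoeff (ν + 1) k r * kummerInt (ν + 1 + k + r + m) (m + 1) -
        (m + 1) * ∑ r ∈ Finset.range (k + 1),
          laguerreCoeff (ν + 1) k r * kummerInt (ν + 1 + k + r + (m + 1 : ℕ)) (m + 1 + 1) := by
      have e1 : ∑ r ∈ Finset.range (k + 1 + 1),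
          laguerreCoeff ν (k + 1) r * kummerInt (ν + (k + 1 : ℕ) + r + m) (m + 1) =
          ∑ r ∈ Finset.range (k + 1), laguerreCoeff (ν + 1) k r *
            (kummerInt (ν + (k + 1 : ℕ) + (r + 1 : ℕ) + m) (m + 1) -
              (ν + 1 + r) * kummerInt (ν + (k + 1 : ℕ) + r + m) (m + 1)) := by
        rw [Finset.sum_range_succ']
        simp only [laguerreCoeff_succ_succ hν, laguerreCoeff_succ_zero ν, sub_mul, mul_sub,
          Finset.sum_sub_distrib]
        rw [Finset.sum_range_succ' (fun r : ℕ => laguerreCoeff (ν + 1) k r *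
          ((ν + 1 + r) * kummerInt (ν + (k + 1 : ℕ) + r + m) (m + 1)))]
        rw [Finset.sum_range_succ (fun r : ℕ => (ν + 2 + r) * laguerreCoeff (ν + 1) k (r + 1) *
          kummerInt (ν + (k + 1 : ℕ) + (r + 1 : ℕ) + m) (m + 1)),
          laguerreCoeff_eq_zero (Nat.lt_succ_self k)]
        have : ∀ r : ℕ, (ν + 2 + r) * laguerreCoeff (ν + 1) k (r + 1) *
          kummerInt (ν + (k + 1 : ℕ) + (r + 1 : ℕ) + m) (m + 1) =
          laguerreCoeff (ν + 1) k (r + 1) *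
          ((ν + 1 + (r + 1 : ℕ)) * kummerInt (ν + (k + 1 : ℕ) + (r + 1 : ℕ) + m) (m + 1)) := by
          intro r; push_cast; ring
        simp only [this]
        push_cast
        ring
      rw [e1, Finset.mul_sum, Finset.mul_sum, ← Finset.sum_sub_distrib]
      refine Finset.sum_congr rfl fun r _ => ?_
      have ha : -1 < ν + 1 + k + r + m := by
        have := k.cast_nonneg (α := ℝ)
        have := r.cast_nonneg (α := ℝ)
        have := m.cast_nonneg (α := ℝ)
        linarith
      have hp := kummerInt_by_parts ha (m + 1)
      push_cast at hp ⊢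
      rw [show ν + (k + 1 : ℝ) + (r + 1) + m = ν + 1 + k + r + m + 1 by ring,
        show ν + (k + 1 : ℝ) + r + m = ν + 1 + k + r + m by ring,
        show ν + 1 + k + r + (m + 1 : ℝ) = ν + 1 + k + r + m + 1 by ring]
      linear_combination -laguerreCoeff (ν + 1) k r * hp
    have ha : -1 < ν + 1 + k + m := by
      have := k.cast_nonneg (α := ℝ)
      have := m.cast_nonneg (α := ℝ)
      linarith
    have hs := kummerInt_eq_add ha (k + m + 1)
    rw [hsum]
    rw [show k + (m + 1) = k + m + 1 by ring] at i2
    rw [show k + 1 + m = k + m + 1 by ring,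
      show ν + ((k + 1 : ℕ) : ℝ) + m = ν + 1 + k + m by push_cast; ring]
    rw [show ν + 1 + k + ((m + 1 : ℕ) : ℝ) = ν + 1 + k + m + 1 by push_cast; ring] at i2
    rw [Nat.factorial_succ m] at i2
    rw [Nat.factorial_succ (k + m)] at i2 ⊢
    push_cast at i2 ⊢
    linear_combination (k + 1 + m : ℝ) * i1 - i2 + (k + m + 1 : ℝ) * (k + m).factorial * hs

/-- The coefficients `d_{k,m}` are, up to the factor `Γ(1+ν) / m!`, functions of `k + m` only. -/
theorem factorial_mul_dCoeff {ν : ℝ} (hν : -1 < ν) (k m : ℕ) :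
    (m.factorial : ℝ) * dCoeff ν k m =
      Real.Gamma (1 + ν) * ((k + m).factorial * kummerInt (ν + k + m) (k + m + 1)) := by
  rw [← sum_laguerreCoeff_mul_kummerInt k hν m]
  unfold dCoeff
  rw [mul_left_comm]
  congr 2
  refine Finset.sum_congr rfl fun r _ => ?_
  have ha : -1 < ν + k + r + m := by
    have := k.cast_nonneg (α := ℝ)
    have := r.cast_nonneg (α := ℝ)
    have := m.cast_nonneg (α := ℝ)
    linarith
  rw [← gamma_mul_tricomiPsi ha m, laguerreCoeff]
  ring_nf

/-! ### The weight and its moments -/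

theorem integrableOn_rho_kernel {ν x : ℝ} (hν : -1 < ν) (hx : 0 < x) :
    IntegrableOn (fun t : ℝ => t ^ (ν - 1) * Real.exp (-t - x / t)) (Ioi 0) := by
  have h := (integrableOn_rpow_mul_exp_neg_mul hν one_pos).const_mul (1 / x)
  simp only [one_mul] at h
  refine Integrable.mono' h ?_ ?_
  · refine ContinuousOn.aestronglyMeasurable (fun t ht => ?_) measurableSet_Ioi
    have ht : (0 : ℝ) < t := ht
    have ht' := ht.ne'
    refine ContinuousAt.continuousWithinAt ?_
    have : ContinuousAt (fun t : ℝ => t ^ (ν - 1)) t :=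
      Real.continuousAt_rpow_const _ _ (Or.inl ht')
    fun_prop (disch := assumption)
  · filter_upwards [ae_restrict_mem measurableSet_Ioi] with t ht
    have ht : (0 : ℝ) < t := ht
    rw [Real.norm_of_nonneg (by positivity)]
    -- `e^{-x/t} ≤ t / x` absorbs the singularity of `t^{ν-1}` at the origin.
    have h1 : Real.exp (-(x / t)) ≤ t / x := by
      rw [Real.exp_neg, inv_le_comm₀ (Real.exp_pos _) (by positivity), inv_div]
      linarith [Real.add_one_le_exp (x / t)]
    rw [sub_eq_add_neg (-t), Real.exp_add, Real.rpow_sub_one ht.ne']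
    calc t ^ ν / t * (Real.exp (-t) * Real.exp (-(x / t)))
        ≤ t ^ ν / t * (Real.exp (-t) * (t / x)) := by gcongr
      _ = 1 / x * (t ^ ν * Real.exp (-t)) := by field_simp

/-- The representation `ρ_ν(x) = ∫_0^∞ t^{ν-1} e^{-t-x/t} dt`, obtained by the substitution
`t = √x e^u`. -/
theorem rho_eq_integral {ν x : ℝ} (hν : -1 < ν) (hx : 0 < x) :
    rho ν x = ∫ t in Ioi (0 : ℝ), t ^ (ν - 1) * Real.exp (-t - x / t) := by
  have hs : 0 < Real.sqrt x := Real.sqrt_pos.2 hx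
  have himg : (fun u : ℝ => Real.sqrt x * Real.exp u) '' univ = Ioi 0 := by
    ext y
    simp only [image_univ, mem_range, mem_Ioi]
    constructor
    · rintro ⟨u, rfl⟩
      positivity
    · intro hy
      exact ⟨Real.log (y / Real.sqrt x), by
        rw [Real.exp_log (by positivity)]
        field_simp⟩
  have hderiv : ∀ u ∈ (univ : Set ℝ), HasDerivWithinAt (fun u : ℝ => Real.sqrt x * Real.exp u)
      (Real.sqrt x * Real.exp u) univ u := fun u _ =>
    ((Real.hasDerivAt_exp u).const_mul _).hasDerivWithinAt
  have hinj : InjOn (fun u : ℝ => Real.sqrt x * Real.exp u) univ := by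
    intro u _ v _ h
    exact Real.exp_injective (mul_left_cancel₀ hs.ne' h)
  have hker : ∀ u : ℝ, |Real.sqrt x * Real.exp u| • ((Real.sqrt x * Real.exp u) ^ (ν - 1) *
      Real.exp (-(Real.sqrt x * Real.exp u) - x / (Real.sqrt x * Real.exp u))) =
      x ^ (ν / 2) * (Real.exp (ν * u) * Real.exp (-(2 * Real.sqrt x) * Real.cosh u)) := by
    intro u
    have hp : 0 < Real.sqrt x * Real.exp u := by positivity
    have e1 : x / (Real.sqrt x * Real.exp u) = Real.sqrt x * Real.exp (-u) := by
      rw [Real.exp_neg]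
      field_simp
      exact (Real.sq_sqrt hx.le).symm
    have e2 : (Real.sqrt x * Real.exp u) ^ ν = x ^ (ν / 2) * Real.exp (ν * u) := by
      rw [Real.mul_rpow hs.le (Real.exp_pos u).le, Real.sqrt_eq_rpow, ← Real.rpow_mul hx.le,
        ← Real.exp_mul]
      ring_nf
    rw [abs_of_pos hp, smul_eq_mul, Real.rpow_sub_one hp.ne', e1, e2, Real.cosh_eq]
    field_simp
    ring_nf
  have hint := integrableOn_rho_kernel hν hx
  rw [← himg, integrableOn_image_iff_integrableOn_abs_deriv_smul MeasurableSet.univ hderiv hinj]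
    at hint
  simp only [hker] at hint
  rw [← himg, integral_image_eq_integral_abs_deriv_smul MeasurableSet.univ hderiv hinj]
  simp only [hker]
  rw [setIntegral_univ, integral_const_mul]
  rw [integrableOn_univ, integrable_const_mul_iff
    (isUnit_iff_ne_zero.2 (Real.rpow_pos_of_pos hx _).ne')] at hint
  have hneg := hint.comp_neg
  -- The two half-lines contribute `e^{νu}` and `e^{-νu}`, which add up to `2 cosh (νu)`.
  rw [← integral_add_compl (measurableSet_Ioi (a := (0 : ℝ))) hint, compl_Ioi,
    ← neg_zero, ← integral_comp_neg_Ioi, neg_zero]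
  simp only [mul_neg, Real.cosh_neg] at hneg ⊢
  rw [← integral_add hint.integrableOn hneg.integrableOn]
  unfold rho besselK
  rw [mul_right_comm, mul_comm, ← integral_const_mul]
  congr 1
  refine integral_congr_ae (Filter.Eventually.of_forall fun u => ?_)
  simp only [Real.cosh_eq (ν * u), neg_mul]
  ring

theorem rho_pos {ν x : ℝ} (hν : -1 < ν) (hx : 0 < x) : 0 < rho ν x := by
  rw [rho_eq_integral hν hx, setIntegral_pos_iff_support_of_nonneg_ae
    _ (integrableOn_rho_kernel hν hx)]
  · rw [inter_eq_right.2]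
    · simp
    · intro t ht
      have ht : (0 : ℝ) < t := ht
      rw [Function.mem_support]
      positivity
  · filter_upwards [ae_restrict_mem measurableSet_Ioi] with t ht
    have ht : (0 : ℝ) < t := ht
    simp only [Pi.zero_apply]
    positivity

theorem weight_pos {ν x : ℝ} (hν : -1 < ν) (hx : 0 < x) : 0 < weight ν x :=
  mul_pos (Real.exp_pos _) (rho_pos hν hx)

theorem weight_moment {ν : ℝ} (hν : -1 < ν) (n : ℕ) :
    IntegrableOn (fun x => x ^ n * weight ν x) (Ioi 0) ∧
      ∫ x in Ioi (0 : ℝ), x ^ n * weight ν x = n.factorial * kummerInt (ν + n) (n + 1) := by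
  have hn : -1 < ν + n := by
    have := n.cast_nonneg (α := ℝ)
    linarith
  have hexp : ∀ x t : ℝ, 0 < t → x ^ n * Real.exp (-x) * (t ^ (ν - 1) * Real.exp (-t - x / t)) =
      t ^ (ν - 1) * Real.exp (-t) * (x ^ n * Real.exp (-((1 + 1 / t) * x))) := by
    intro x t ht
    have : Real.exp (-x) * Real.exp (-t - x / t) =
        Real.exp (-t) * Real.exp (-((1 + 1 / t) * x)) := by
      rw [← Real.exp_add, ← Real.exp_add]
      ring_nf
    linear_combination (x ^ n * t ^ (ν - 1)) * this
  have hsw := integrableOn_and_integral_swap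
    (F := fun x t => x ^ n * Real.exp (-x) * (t ^ (ν - 1) * Real.exp (-t - x / t)))
    (g := fun t => n.factorial * (t ^ (ν + n) * Real.exp (-t) / (1 + t) ^ (n + 1)))
    ?_ ?_ ?_ ?_ ?_
  · have heq : ∀ x ∈ Ioi (0 : ℝ), ∫ t in Ioi (0 : ℝ),
        x ^ n * Real.exp (-x) * (t ^ (ν - 1) * Real.exp (-t - x / t)) = x ^ n * weight ν x := by
      intro x hx
      rw [integral_const_mul, ← rho_eq_integral hν hx, weight, mul_assoc]
    refine ⟨hsw.1.congr_fun heq measurableSet_Ioi, ?_⟩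
    rw [← setIntegral_congr_fun measurableSet_Ioi heq, hsw.2, integral_const_mul, kummerInt]
  · intro p hp
    obtain ⟨x, t⟩ := p
    have ht : t ≠ 0 := (show (0 : ℝ) < t from hp.2).ne'
    refine ContinuousAt.continuousWithinAt ?_
    have : ContinuousAt (fun p : ℝ × ℝ => p.2 ^ (ν - 1)) (x, t) :=
      ContinuousAt.rpow_const continuousAt_snd (Or.inl ht)
    have hdiv : ContinuousAt (fun p : ℝ × ℝ => p.1 / p.2) (x, t) :=
      continuousAt_fst.div continuousAt_snd ht
    exact (by fun_prop : ContinuousAt (fun p : ℝ × ℝ => p.1 ^ n * Real.exp (-p.1)) (x, t)).mul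
      (this.mul ((continuousAt_snd.neg.sub hdiv).rexp))
  · intro x hx t ht
    positivity
  · intro t ht
    simp only [hexp _ t ht]
    exact (integrableOn_pow_mul_exp_neg_mul n (by positivity : 0 < 1 + 1 / t)).const_mul _
  · intro t ht
    simp only [hexp _ t ht]
    rw [integral_const_mul, integral_pow_mul_exp_neg_mul n (by positivity : 0 < 1 + 1 / t),
      Real.rpow_sub_one ht.ne', Real.rpow_add ht, Real.rpow_natCast,
      show 1 + 1 / t = (1 + t) / t by field_simp; ring, div_pow]
    field_simp
    ring
  · exact (integrableOn_kummerInt hn _).const_mul _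

theorem integrableOn_eval_mul_weight {ν : ℝ} (hν : -1 < ν) (p : ℝ[X]) :
    IntegrableOn (fun x => p.eval x * weight ν x) (Ioi 0) := by
  simp only [eval_eq_sum_range, Finset.sum_mul, mul_assoc]
  exact integrable_finsetSum _ fun i _ => (weight_moment hν i).1.const_mul _

/-- The linear functional `p ↦ ∫_0^∞ p(x) e^{-x} ρ_ν(x) dx`. -/
def weightFunctional {ν : ℝ} (hν : -1 < ν) : ℝ[X] →ₗ[ℝ] ℝ where
  toFun p := ∫ x in Ioi (0 : ℝ), p.eval x * weight ν x
  map_add' p q := by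
    simp only [eval_add, add_mul]
    exact integral_add (integrableOn_eval_mul_weight hν p) (integrableOn_eval_mul_weight hν q)
  map_smul' c p := by
    simp only [eval_smul, smul_eq_mul, mul_assoc, integral_const_mul, RingHom.id_apply]

theorem weightFunctional_pos {ν : ℝ} (hν : -1 < ν) {p : ℝ[X]} (hp : p ≠ 0)
    (h0 : ∀ x > 0, 0 ≤ p.eval x) : 0 < weightFunctional hν p := by
  change 0 < ∫ x in Ioi (0 : ℝ), p.eval x * weight ν x
  rw [setIntegral_pos_iff_support_of_nonneg_ae _ (integrableOn_eval_mul_weight hν p)]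
  · have hsub : Ioi (0 : ℝ) \ (p.roots.toFinset : Set ℝ) ⊆
        (Function.support fun x => p.eval x * weight ν x) ∩ Ioi 0 := by
      rintro x ⟨hx, hr⟩
      refine ⟨?_, hx⟩
      rw [Function.mem_support]
      refine mul_ne_zero (fun h => hr ?_) (weight_pos hν hx).ne'
      simpa [hp] using h
    refine lt_of_lt_of_le ?_ (measure_mono hsub)
    rw [measure_sdiff_null (p.roots.toFinset.finite_toSet.measure_zero _)]
    simp
  · filter_upwards [ae_restrict_mem measurableSet_Ioi] with x hx
    exact mul_nonneg (h0 x hx) (weight_pos hν hx).le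

/-- The Hankel structure: `m! d_{k,m} = Γ(1+ν) μ_{k+m}`, where `μ_n` is the `n`-th moment of the
weight. -/
theorem factorial_mul_dCoeff_eq_moment {ν : ℝ} (hν : -1 < ν) (k m : ℕ) :
    (m.factorial : ℝ) * dCoeff ν k m =
      Real.Gamma (1 + ν) * weightFunctional hν (X ^ (k + m)) := by
  rw [factorial_mul_dCoeff hν]
  have h := (weight_moment hν (k + m)).2
  change _ = _ * ∫ x in Ioi (0 : ℝ), (X ^ (k + m) : ℝ[X]).eval x * weight ν x
  simp only [eval_pow, eval_X]
  rw [h]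
  push_cast
  rw [add_assoc]

/-! ### Orthogonality with respect to a linear functional -/

theorem map_mul_eq_zero_of_forall_pow {L : ℝ[X] →ₗ[ℝ] ℝ} {p q : ℝ[X]} {n : ℕ}
    (h : ∀ i < n, L (p * X ^ i) = 0) (hq : q.degree < n) : L (p * q) = 0 := by
  by_cases h0 : q = 0
  · simp [h0]
  rw [q.as_sum_range_C_mul_X_pow' ((natDegree_lt_iff_degree_lt h0).2 hq), Finset.mul_sum, map_sum]
  refine Finset.sum_eq_zero fun i hi => ?_
  rw [mul_left_comm, ← smul_eq_C_mul, map_smul, h i (Finset.mem_range.1 hi), smul_zero]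

theorem degree_sub_C_mul_lt {p q : ℝ[X]} {n : ℕ} (hp : p.natDegree = n) (hp0 : p.coeff n ≠ 0)
    (hq : q.degree < ((n + 1 : ℕ) : WithBot ℕ)) :
    (q - C (q.coeff n / p.coeff n) * p).degree < n := by
  rw [degree_lt_iff_coeff_zero] at hq ⊢
  intro m hm
  rw [coeff_sub, coeff_C_mul]
  rcases hm.eq_or_lt with rfl | hm
  · rw [div_mul_cancel₀ _ hp0, sub_self]
  · rw [hq m hm, coeff_eq_zero_of_natDegree_lt (p := p) (n := m) (by rwa [hp])]
    simp

section Orthonormal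

variable {L : ℝ[X] →ₗ[ℝ] ℝ} {P : ℕ → ℝ[X]}

theorem coeff_ne_zero_of_orthonormal (hd : ∀ n, (P n).natDegree = n)
    (ho : ∀ m n, L (P m * P n) = if m = n then 1 else 0) (n : ℕ) : (P n).coeff n ≠ 0 := by
  have h0 : P n ≠ 0 := by
    intro h
    simpa [h] using ho n n
  have h1 := leadingCoeff_ne_zero.2 h0
  rwa [leadingCoeff, hd] at h1

theorem orthonormal_mul_of_degree_lt (hd : ∀ n, (P n).natDegree = n)
    (ho : ∀ m n, L (P m * P n) = if m = n then 1 else 0) {n : ℕ} {q : ℝ[X]}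
    (hq : q.degree < n) : L (P n * q) = 0 := by
  suffices H : ∀ d ≤ n, ∀ q : ℝ[X], q.degree < d → L (P n * q) = 0 from H n le_rfl q hq
  intro d
  induction d with
  | zero =>
    intro _ q hq
    have : q = 0 := by simpa [degree_eq_bot] using hq
    simp [this]
  | succ d ih =>
    intro hdn q hq
    have h1 := ih (by omega) _
      (degree_sub_C_mul_lt (hd d) (coeff_ne_zero_of_orthonormal hd ho d) hq)
    rwa [mul_sub, map_sub, mul_left_comm, ← smul_eq_C_mul, map_smul, ho, if_neg (by omega),
      smul_zero, sub_zero] at h1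

theorem orthonormal_mul_eq_coeff_div (hd : ∀ n, (P n).natDegree = n)
    (ho : ∀ m n, L (P m * P n) = if m = n then 1 else 0) {n : ℕ} {q : ℝ[X]}
    (hq : q.degree < ((n + 1 : ℕ) : WithBot ℕ)) : L (P n * q) = q.coeff n / (P n).coeff n := by
  have h1 := orthonormal_mul_of_degree_lt hd ho
    (degree_sub_C_mul_lt (hd n) (coeff_ne_zero_of_orthonormal hd ho n) hq)
  rw [mul_sub, map_sub, mul_left_comm, ← smul_eq_C_mul, map_smul, ho, if_pos rfl,
    smul_eq_mul, mul_one] at h1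
  linarith

/-- Two polynomials of degree at most `n`, both orthogonal to all lower degrees, are
proportional. -/
theorem eq_C_mul_of_orthogonal (hpos : ∀ p : ℝ[X], p ≠ 0 → 0 < L (p * p)) {p q : ℝ[X]} {n : ℕ}
    (hp : p.natDegree = n) (hp0 : p.coeff n ≠ 0) (hq : q.degree < ((n + 1 : ℕ) : WithBot ℕ))
    (op : ∀ r : ℝ[X], r.degree < n → L (p * r) = 0)
    (oq : ∀ r : ℝ[X], r.degree < n → L (q * r) = 0) :
    q = C (q.coeff n / p.coeff n) * p := by
  have hdeg := degree_sub_C_mul_lt hp hp0 hq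
  rw [← sub_eq_zero]
  by_contra hne
  refine (hpos _ hne).ne' ?_
  rw [sub_mul, map_sub, oq _ hdeg, mul_assoc, ← smul_eq_C_mul, map_smul, op _ hdeg, smul_zero,
    sub_zero]

/-- The three-term recurrence, with coefficients read off from the two leading coefficients. -/
theorem three_term_recurrence (hpos : ∀ p : ℝ[X], p ≠ 0 → 0 < L (p * p))
    (hd : ∀ n, (P n).natDegree = n)
    (ho : ∀ m n, L (P m * P n) = if m = n then 1 else 0) (n : ℕ) :
    X * P (n + 1) = C ((P (n + 1)).coeff (n + 1) / (P (n + 2)).coeff (n + 2)) * P (n + 2) +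
      C ((P (n + 1)).coeff n / (P (n + 1)).coeff (n + 1) -
        (P (n + 2)).coeff (n + 1) / (P (n + 2)).coeff (n + 2)) * P (n + 1) +
      C ((P n).coeff n / (P (n + 1)).coeff (n + 1)) * P n := by
  have c0 := coeff_ne_zero_of_orthonormal hd ho n
  have c1 := coeff_ne_zero_of_orthonormal hd ho (n + 1)
  have c2 := coeff_ne_zero_of_orthonormal hd ho (n + 2)
  have hz : ∀ {k m : ℕ}, k < m → (P k).coeff m = 0 := fun h =>
    coeff_eq_zero_of_natDegree_lt (by rwa [hd])
  rw [← sub_eq_zero]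
  set R := X * P (n + 1) - (C ((P (n + 1)).coeff (n + 1) / (P (n + 2)).coeff (n + 2)) * P (n + 2) +
      C ((P (n + 1)).coeff n / (P (n + 1)).coeff (n + 1) -
        (P (n + 2)).coeff (n + 1) / (P (n + 2)).coeff (n + 2)) * P (n + 1) +
      C ((P n).coeff n / (P (n + 1)).coeff (n + 1)) * P n) with hR
  have hdeg : R.degree < ((n + 1 : ℕ) : WithBot ℕ) := by
    rw [degree_lt_iff_coeff_zero]
    intro m hm
    obtain ⟨m, rfl⟩ : ∃ k, m = k + 1 := ⟨m - 1, by omega⟩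
    simp only [hR, coeff_sub, coeff_add, coeff_C_mul, coeff_X_mul]
    rw [hz (show n < m + 1 by omega)]
    rcases Nat.lt_trichotomy m (n + 1) with h | h | h
    · obtain rfl : m = n := by omega
      field_simp
      ring
    · subst h
      rw [hz (show n + 1 < n + 1 + 1 by omega)]
      field_simp
      ring
    · rw [hz h, hz (show n + 1 < m + 1 by omega), hz (show n + 2 < m + 1 by omega)]
      ring
  by_contra hne
  refine (hpos _ hne).ne' ?_
  have o2 := orthonormal_mul_of_degree_lt hd ho (n := n + 2)
    (hdeg.trans (by exact_mod_cast Nat.lt_succ_self _))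
  have o1 := orthonormal_mul_of_degree_lt hd ho hdeg
  have o0 := orthonormal_mul_eq_coeff_div hd ho hdeg
  have ox : L (P (n + 1) * (X * R)) = R.coeff n / (P (n + 1)).coeff (n + 1) := by
    rw [orthonormal_mul_eq_coeff_div hd ho, coeff_X_mul]
    rw [degree_lt_iff_coeff_zero] at hdeg ⊢
    intro m hm
    obtain ⟨m, rfl⟩ : ∃ k, m = k + 1 := ⟨m - 1, by omega⟩
    rw [coeff_X_mul, hdeg m (by omega)]
  have hexp : R * R = P (n + 1) * (X * R) -
      ((P (n + 1)).coeff (n + 1) / (P (n + 2)).coeff (n + 2)) • (P (n + 2) * R) -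
      ((P (n + 1)).coeff n / (P (n + 1)).coeff (n + 1) -
        (P (n + 2)).coeff (n + 1) / (P (n + 2)).coeff (n + 2)) • (P (n + 1) * R) -
      ((P n).coeff n / (P (n + 1)).coeff (n + 1)) • (P n * R) := by
    simp only [smul_eq_C_mul]
    conv_lhs => arg 1; rw [hR]
    ring
  rw [hexp, map_sub, map_sub, map_sub, map_smul, map_smul, map_smul, o2, o1, o0, ox]
  simp only [smul_eq_mul]
  field_simp
  ring

theorem first_recurrence (hd : ∀ n, (P n).natDegree = n)
    (ho : ∀ m n, L (P m * P n) = if m = n then 1 else 0) :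
    X * P 0 = C ((P 0).coeff 0 / (P 1).coeff 1) * P 1 +
      C (-((P 1).coeff 0 / (P 1).coeff 1)) * P 0 := by
  have c1 := coeff_ne_zero_of_orthonormal hd ho 1
  have hz : ∀ {k m : ℕ}, k < m → (P k).coeff m = 0 := fun h =>
    coeff_eq_zero_of_natDegree_lt (by rwa [hd])
  ext m
  rcases m with _ | _ | m
  · simp only [coeff_add, coeff_C_mul, coeff_X_mul_zero]
    field_simp
    ring
  · simp only [coeff_add, coeff_C_mul, coeff_X_mul, zero_add]
    rw [hz zero_lt_one]
    field_simp
    ring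
  · simp only [coeff_add, coeff_C_mul, coeff_X_mul]
    rw [hz (show 0 < m + 1 by omega), hz (show 0 < m + 1 + 1 by omega),
      hz (show 1 < m + 1 + 1 by omega)]
    ring

end Orthonormal

/-! ### The determinants -/

theorem gamma_one_add_pos {ν : ℝ} (hν : -1 < ν) : 0 < Real.Gamma (1 + ν) :=
  Real.Gamma_pos_of_pos (by linarith)

theorem dCoeff_eq {ν : ℝ} (hν : -1 < ν) (k m : ℕ) :
    dCoeff ν k m = Real.Gamma (1 + ν) / m.factorial * weightFunctional hν (X ^ (k + m)) := by
  have h := factorial_mul_dCoeff_eq_moment hν k m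
  have hm : (m.factorial : ℝ) ≠ 0 := by positivity
  field_simp
  linarith

theorem weightFunctional_mul_self_pos {ν : ℝ} (hν : -1 < ν) (p : ℝ[X]) (hp : p ≠ 0) :
    0 < weightFunctional hν (p * p) :=
  weightFunctional_pos hν (mul_ne_zero hp hp) fun x _ => by
    rw [eval_mul]
    exact mul_self_nonneg _

/-- A kernel vector of the matrix of `D_n` is a polynomial `q` of degree `< n` with
`∫ q(x)² x e^{-x} ρ_ν(x) dx = 0`. -/
theorem D_ne_zero {ν : ℝ} (hν : -1 < ν) (n : ℕ) : D ν n ≠ 0 := by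
  unfold D
  rw [Ne, ← Matrix.exists_mulVec_eq_zero_iff]
  rintro ⟨v, hv, h⟩
  set q : ℝ[X] := ∑ j : Fin n, C (v j) * X ^ (j : ℕ) with hq
  have hqc : ∀ j : Fin n, q.coeff j = v j := by
    intro j
    simp [hq, finsetSum_coeff, coeff_X_pow, Fin.val_inj]
  have hq0 : q ≠ 0 := by
    intro h0
    refine hv (funext fun j => ?_)
    rw [← hqc j, h0]
    simp
  have hdeg : q.degree < n := by
    rw [degree_lt_iff_coeff_zero]
    intro m hm
    simp only [hq, finsetSum_coeff, coeff_C_mul_X_pow]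
    exact Finset.sum_eq_zero fun j _ => if_neg (by omega)
  have hmul : ∀ i < n, weightFunctional hν (X * q * X ^ i) = 0 := by
    intro i hi
    have hi' := congrFun h ⟨i, hi⟩
    simp only [Matrix.mulVec, dotProduct, Matrix.of_apply, dCoeff_eq hν, Pi.zero_apply,
      mul_assoc] at hi'
    rw [← Finset.mul_sum, mul_eq_zero_iff_left
      (div_ne_zero (gamma_one_add_pos hν).ne' (by positivity))] at hi'
    rw [hq, Finset.mul_sum, Finset.sum_mul, map_sum, ← hi']
    refine Finset.sum_congr rfl fun j _ => ?_
    rw [mul_comm (weightFunctional hν _), ← smul_eq_mul (v j), ← map_smul, smul_eq_C_mul]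
    congr 1
    ring
  refine (weightFunctional_pos hν (p := X * q * q) (by simp [hq0, X_ne_zero])
    fun x hx => ?_).ne' (map_mul_eq_zero_of_forall_pow hmul hdeg)
  rw [mul_assoc, eval_mul, eval_mul, eval_X]
  exact mul_nonneg hx.le (mul_self_nonneg _)

theorem DRepl_zero (ν : ℝ) (n : ℕ) : DRepl ν n 0 = -D ν n := by simp [DRepl]

theorem DRepl_succ (ν : ℝ) {n : ℕ} (j : Fin n) :
    DRepl ν n (j + 1) =
      Matrix.cramer (Matrix.of fun i j : Fin n => dCoeff ν ((j : ℕ) + 1) (i : ℕ))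
        (fun i => dCoeff ν 0 i) j := by
  rw [Matrix.cramer_apply, DRepl, if_neg (Nat.succ_ne_zero _)]
  congr 1
  ext i j'
  simp [Matrix.updateCol_apply, Fin.val_inj]

/-- Cramer's rule for the system defining the coefficients of the orthogonal polynomial. -/
theorem sum_DRepl_mul_dCoeff (ν : ℝ) {n i : ℕ} (hi : i < n) :
    ∑ k ∈ Finset.range (n + 1), DRepl ν n k * dCoeff ν k i = 0 := by
  have h := congrFun (Matrix.mulVec_cramer
    (Matrix.of fun i j : Fin n => dCoeff ν ((j : ℕ) + 1) (i : ℕ))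
    (fun i => dCoeff ν 0 i)) ⟨i, hi⟩
  simp only [Matrix.mulVec, dotProduct, ← DRepl_succ, Matrix.of_apply, Pi.smul_apply,
    smul_eq_mul] at h
  rw [Finset.sum_range_succ', DRepl_zero,
    ← Fin.sum_univ_eq_sum_range (fun k => DRepl ν n (k + 1) * dCoeff ν (k + 1) i)]
  simp only [mul_comm (DRepl _ _ _)]
  rw [h, D]
  ring

/-- The polynomial `∑_k D_{n,k} x^k`, a multiple of the orthogonal polynomial of degree `n`. -/
def detPoly (ν : ℝ) (n : ℕ) : ℝ[X] :=
  ∑ k ∈ Finset.range (n + 1), C (DRepl ν n k) * X ^ k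

theorem coeff_detPoly (ν : ℝ) (n k : ℕ) :
    (detPoly ν n).coeff k = if k ≤ n then DRepl ν n k else 0 := by
  simp [detPoly, finsetSum_coeff, coeff_X_pow]

theorem detPoly_degree_lt (ν : ℝ) (n : ℕ) : (detPoly ν n).degree < ((n + 1 : ℕ) : WithBot ℕ) := by
  rw [degree_lt_iff_coeff_zero]
  intro m hm
  rw [coeff_detPoly, if_neg (by omega)]

theorem weightFunctional_detPoly_mul_X_pow {ν : ℝ} (hν : -1 < ν) (n i : ℕ) :
    weightFunctional hν (detPoly ν n * X ^ i) =
      ∑ k ∈ Finset.range (n + 1), DRepl ν n k * weightFunctional hν (X ^ (k + i)) := by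
  rw [detPoly, Finset.sum_mul, map_sum]
  refine Finset.sum_congr rfl fun k _ => ?_
  rw [mul_assoc, ← pow_add, ← smul_eq_C_mul, map_smul, smul_eq_mul]

theorem weightFunctional_detPoly_mul {ν : ℝ} (hν : -1 < ν) {n : ℕ} {q : ℝ[X]}
    (hq : q.degree < n) : weightFunctional hν (detPoly ν n * q) = 0 := by
  refine map_mul_eq_zero_of_forall_pow (fun i hi => ?_) hq
  have h := sum_DRepl_mul_dCoeff ν hi
  simp only [dCoeff_eq hν, mul_left_comm (DRepl _ _ _)] at h
  rwa [← Finset.mul_sum, ← weightFunctional_detPoly_mul_X_pow, mul_eq_zero_iff_left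
    (div_ne_zero (gamma_one_add_pos hν).ne' (by positivity))] at h

theorem normSum_eq {ν : ℝ} (hν : -1 < ν) (n : ℕ) :
    normSum ν n = Real.Gamma (1 + ν) * weightFunctional hν (detPoly ν n * X ^ n) := by
  rw [weightFunctional_detPoly_mul_X_pow, normSum, Finset.mul_sum]
  refine Finset.sum_congr rfl fun k _ => ?_
  rw [mul_assoc, factorial_mul_dCoeff_eq_moment hν, zero_add, add_comm n k]
  ring

theorem DRepl_mul_normSum {ν : ℝ} (hν : -1 < ν) (n : ℕ) :
    DRepl ν n n * normSum ν n =
      Real.Gamma (1 + ν) * weightFunctional hν (detPoly ν n * detPoly ν n) := by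
  have hlow : weightFunctional hν (detPoly ν n * (detPoly ν n - C (DRepl ν n n) * X ^ n)) = 0 := by
    refine weightFunctional_detPoly_mul hν ?_
    rw [degree_lt_iff_coeff_zero]
    intro m hm
    rw [coeff_sub, coeff_C_mul_X_pow, coeff_detPoly]
    rcases hm.eq_or_lt with rfl | hm
    · simp
    · rw [if_neg (by omega), if_neg (by omega), sub_zero]
  rw [mul_sub, map_sub, mul_left_comm, ← smul_eq_C_mul, map_smul, smul_eq_mul, sub_eq_zero] at hlow
  rw [hlow, normSum_eq hν]
  ring

theorem detPoly_ne_zero {ν : ℝ} (hν : -1 < ν) (n : ℕ) : detPoly ν n ≠ 0 := by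
  intro h
  have h0 := coeff_detPoly ν n 0
  rw [h, if_pos n.zero_le, DRepl_zero, coeff_zero] at h0
  exact D_ne_zero hν n (by linarith)

theorem DRepl_mul_normSum_pos {ν : ℝ} (hν : -1 < ν) (n : ℕ) :
    0 < DRepl ν n n * normSum ν n := by
  rw [DRepl_mul_normSum hν]
  exact mul_pos (gamma_one_add_pos hν)
    (weightFunctional_mul_self_pos hν _ (detPoly_ne_zero hν n))

theorem hankel_posDef {ν : ℝ} (hν : -1 < ν) (n : ℕ) :
    (Matrix.of fun i j : Fin n => weightFunctional hν (X ^ ((j : ℕ) + (i : ℕ)))).PosDef := by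
  refine Matrix.PosDef.of_dotProduct_mulVec_pos ?_ fun v hv => ?_
  · ext i j
    simp [add_comm]
  set q : ℝ[X] := ∑ j : Fin n, C (v j) * X ^ (j : ℕ) with hq
  have hq0 : q ≠ 0 := by
    intro h0
    refine hv (funext fun j => ?_)
    have : q.coeff j = v j := by simp [hq, finsetSum_coeff, coeff_X_pow, Fin.val_inj]
    rw [← this, h0]
    simp
  refine (weightFunctional_mul_self_pos hν q hq0).trans_eq ?_
  rw [hq, Finset.sum_mul_sum, map_sum]
  simp only [dotProduct, Matrix.mulVec, star_trivial, Matrix.of_apply, map_sum, Finset.mul_sum]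
  refine Finset.sum_congr rfl fun i _ => Finset.sum_congr rfl fun j _ => ?_
  rw [mul_comm (weightFunctional hν _), ← smul_eq_mul (v j), ← smul_eq_mul (v i), ← map_smul,
    ← map_smul, smul_eq_C_mul, smul_eq_C_mul]
  congr 1
  ring

/-- Up to a cyclic permutation of its columns and positive row factors, `D_{n,n}` is a Hankel
determinant of moments. -/
theorem neg_one_pow_mul_DRepl_neg {ν : ℝ} (hν : -1 < ν) (n : ℕ) :
    (-1) ^ n * DRepl ν n n < 0 := by
  rcases n with _ | n
  · simp [DRepl, D]
  have hmat : (Matrix.of fun i j : Fin (n + 1) =>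
      if (j : ℕ) + 1 = n + 1 then dCoeff ν 0 (i : ℕ) else dCoeff ν ((j : ℕ) + 1) (i : ℕ)) =
      (Matrix.of fun i j : Fin (n + 1) => Real.Gamma (1 + ν) / (i : ℕ).factorial *
        (Matrix.of fun i j : Fin (n + 1) =>
          weightFunctional hν (X ^ ((j : ℕ) + (i : ℕ)))) i j).submatrix id
        (finRotate (n + 1)) := by
    ext i j
    simp only [Matrix.of_apply, Matrix.submatrix_apply, id, ← dCoeff_eq hν, coe_finRotate,
      Fin.ext_iff, Fin.val_last, Nat.add_right_cancel_iff]
    split_ifs <;> rfl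
  rw [DRepl, if_neg (Nat.succ_ne_zero n), hmat, Matrix.det_permute', sign_finRotate,
    Matrix.det_mul_column, Nat.add_sub_cancel]
  have h1 := (hankel_posDef hν (n + 1)).det_pos
  have h2 : 0 < ∏ i : Fin (n + 1), Real.Gamma (1 + ν) / ((i : ℕ).factorial : ℝ) :=
    Finset.prod_pos fun i _ => div_pos (gamma_one_add_pos hν) (by positivity)
  have h3 : ((-1 : ℝ) ^ n) * (-1) ^ n = 1 := by rw [← mul_pow]; simp
  have h4 := mul_pos h2 h1
  push_cast
  rw [pow_succ]
  set c := (∏ i : Fin (n + 1), Real.Gamma (1 + ν) / ((i : ℕ).factorial : ℝ)) *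
    Matrix.det (Matrix.of fun i j : Fin (n + 1) =>
      weightFunctional hν (X ^ ((j : ℕ) + (i : ℕ)))) with hc
  have : (-1 : ℝ) ^ n * -1 * ((-1) ^ n * c) = -c := by linear_combination -c * h3
  rw [this]
  linarith

theorem DRepl_self_ne_zero {ν : ℝ} (hν : -1 < ν) (n : ℕ) : DRepl ν n n ≠ 0 := by
  intro h
  simpa [h] using neg_one_pow_mul_DRepl_neg hν n

theorem natDegree_detPoly {ν : ℝ} (hν : -1 < ν) (n : ℕ) : (detPoly ν n).natDegree = n := by
  refine natDegree_eq_of_le_of_coeff_ne_zero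
    (Nat.lt_succ_iff.1 ((natDegree_lt_iff_degree_lt (detPoly_ne_zero hν n)).2
      (detPoly_degree_lt ν n))) ?_
  rw [coeff_detPoly, if_pos le_rfl]
  exact DRepl_self_ne_zero hν n

/-! ### Orthonormal sequences -/

theorem IsOrthonormalSeq.weightFunctional_mul {ν : ℝ} (hν : -1 < ν) {P : ℕ → ℝ[X]}
    (hP : IsOrthonormalSeq ν P) (m n : ℕ) :
    weightFunctional hν (P m * P n) = if m = n then 1 else 0 := by
  rw [← hP.integral_eq m n]
  simp [weightFunctional]

/-- The positive root `(Γ(1+ν) / (D_{n,n} S_n))^{1/2}`, the reciprocal of the norm of `detPoly`. -/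
def normFactor (ν : ℝ) (n : ℕ) : ℝ :=
  Real.sqrt (Real.Gamma (1 + ν) / (DRepl ν n n * normSum ν n))

theorem normFactor_pos {ν : ℝ} (hν : -1 < ν) (n : ℕ) : 0 < normFactor ν n :=
  Real.sqrt_pos.2 (div_pos (gamma_one_add_pos hν) (DRepl_mul_normSum_pos hν n))

theorem normFactor_sq_mul {ν : ℝ} (hν : -1 < ν) (n : ℕ) :
    normFactor ν n ^ 2 * weightFunctional hν (detPoly ν n * detPoly ν n) = 1 := by
  have hG := gamma_one_add_pos hν
  have hL := weightFunctional_mul_self_pos hν _ (detPoly_ne_zero hν n)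
  rw [normFactor, Real.sq_sqrt (div_pos hG (DRepl_mul_normSum_pos hν n)).le,
    DRepl_mul_normSum hν]
  field_simp

theorem IsOrthonormalSeq.eq_C_mul_detPoly {ν : ℝ} (hν : -1 < ν) {P : ℕ → ℝ[X]}
    (hP : IsOrthonormalSeq ν P) (n : ℕ) :
    P n = C ((P n).coeff n / DRepl ν n n) * detPoly ν n := by
  have ho := hP.weightFunctional_mul hν
  have h := eq_C_mul_of_orthogonal (weightFunctional_mul_self_pos hν)
    (natDegree_detPoly hν n) (q := P n)
    (by rw [coeff_detPoly, if_pos le_rfl]; exact DRepl_self_ne_zero hν n) ?_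
    (fun r hr => weightFunctional_detPoly_mul hν hr)
    (fun r hr => orthonormal_mul_of_degree_lt hP.natDegree_eq ho hr)
  · rwa [coeff_detPoly, if_pos le_rfl] at h
  · refine (degree_le_natDegree).trans_lt ?_
    rw [hP.natDegree_eq]
    exact_mod_cast Nat.lt_succ_self n

theorem IsOrthonormalSeq.leadingRatio_eq {ν : ℝ} (hν : -1 < ν) {P : ℕ → ℝ[X]}
    (hP : IsOrthonormalSeq ν P) (n : ℕ) :
    (P n).coeff n / DRepl ν n n = normFactor ν n ∨
      (P n).coeff n / DRepl ν n n = -normFactor ν n := by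
  have h1 := hP.weightFunctional_mul hν n n
  rw [hP.eq_C_mul_detPoly hν n, if_pos rfl, mul_mul_mul_comm, ← C_mul, ← smul_eq_C_mul, map_smul,
    smul_eq_mul, ← normFactor_sq_mul hν n] at h1
  have h2 := mul_right_cancel₀
    (weightFunctional_mul_self_pos hν _ (detPoly_ne_zero hν n)).ne' h1
  exact sq_eq_sq_iff_eq_or_eq_neg.1 (by rw [← h2]; ring)

theorem IsOrthonormalSeq.leadingRatio_eq_of_pos {ν : ℝ} (hν : -1 < ν) {P : ℕ → ℝ[X]}
    (hP : IsOrthonormalSeq ν P) {n : ℕ} (hn : 0 < (P n).coeff n) :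
    (P n).coeff n / DRepl ν n n = -((-1) ^ n * normFactor ν n) := by
  have hD := neg_one_pow_mul_DRepl_neg hν n
  have hN := normFactor_pos hν n
  have h0 := DRepl_self_ne_zero hν n
  have hr : 0 < (P n).coeff n / DRepl ν n n * DRepl ν n n := by rwa [div_mul_cancel₀ _ h0]
  rcases hP.leadingRatio_eq hν n with h | h <;> rw [h] at hr ⊢ <;>
    rcases neg_one_pow_eq_or ℝ n with e | e <;> rw [e] at hD ⊢ <;> nlinarith

theorem isOrthonormalSeq_C_mul_detPoly {ν : ℝ} (hν : -1 < ν) :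
    IsOrthonormalSeq ν fun n => C (-((-1) ^ n * normFactor ν n)) * detPoly ν n where
  natDegree_eq n := by
    rw [natDegree_C_mul, natDegree_detPoly hν]
    have := (normFactor_pos hν n).ne'
    simp [this]
  integral_eq m n := by
    have hlt : ∀ {m n : ℕ}, m < n → weightFunctional hν (detPoly ν n * detPoly ν m) = 0 := by
      intro m n h
      refine weightFunctional_detPoly_mul hν ((detPoly_degree_lt ν m).trans_le ?_)
      exact_mod_cast h
    simp only [← eval_mul]
    change weightFunctional hν _ = _
    rw [mul_mul_mul_comm, ← C_mul, ← smul_eq_C_mul, map_smul, smul_eq_mul]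
    rcases lt_trichotomy m n with h | rfl | h
    · rw [mul_comm (detPoly ν m), hlt h, if_neg h.ne, mul_zero]
    · have h3 : ((-1 : ℝ) ^ m) * (-1) ^ m = 1 := by rw [← mul_pow]; simp
      rw [if_pos rfl]
      refine Eq.trans ?_ (normFactor_sq_mul hν m)
      linear_combination (normFactor ν m ^ 2 *
        weightFunctional hν (detPoly ν m * detPoly ν m)) * h3
    · rw [hlt h, if_neg h.ne', mul_zero]

theorem IsOrthonormalSeq.coeff_eq {ν : ℝ} (hν : -1 < ν) {P : ℕ → ℝ[X]}
    (hP : IsOrthonormalSeq ν P) {n k : ℕ} (hk : k ≤ n) :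
    (P n).coeff k = (P n).coeff n / DRepl ν n n * DRepl ν n k := by
  conv_lhs => rw [hP.eq_C_mul_detPoly hν n]
  rw [coeff_C_mul, coeff_detPoly, if_pos hk]

end PrudnikovType

end

theorem theorem1 (ν : ℝ) (hν : -1 < ν) :
    -- all polynomials are integrable against the weight
    (∀ p : ℝ[X], IntegrableOn (fun x => p.eval x * PrudnikovType.weight ν x) (Ioi 0)) ∧
    -- existence and uniqueness of the orthonormal polynomials with positive leading coefficients
    (∃! P : ℕ → ℝ[X],
      PrudnikovType.IsOrthonormalSeq ν P ∧ ∀ n, 0 < (P n).coeff n) ∧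
    -- denominators below do not vanish and the quantity under the square root is positive
    (∀ n, PrudnikovType.D ν n ≠ 0 ∧ PrudnikovType.DRepl ν n n ≠ 0 ∧
      0 < PrudnikovType.DRepl ν n n * PrudnikovType.normSum ν n) ∧
    ∀ P : ℕ → ℝ[X], PrudnikovType.IsOrthonormalSeq ν P →
      -- the coefficients `a_{n,k}`, `1 ≤ k ≤ n`, in terms of the free term
      (∀ n k : ℕ, 1 ≤ k → k ≤ n →
        (P n).coeff k =
          -((P n).coeff 0 * (PrudnikovType.DRepl ν n k / PrudnikovType.D ν n))) ∧
      -- the free term `a_{n,0}`, up to sign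
      (∀ n, (P n).coeff 0 = PrudnikovType.D ν n * Real.sqrt (Real.Gamma (1 + ν) /
            (PrudnikovType.DRepl ν n n * PrudnikovType.normSum ν n)) ∨
          (P n).coeff 0 = -(PrudnikovType.D ν n * Real.sqrt (Real.Gamma (1 + ν) /
            (PrudnikovType.DRepl ν n n * PrudnikovType.normSum ν n)))) ∧
      -- the sign of the free term for a positive leading coefficient
      (∀ n, 0 < (P n).coeff n →
        (P n).coeff 0 = (-1) ^ n * (PrudnikovType.D ν n * Real.sqrt (Real.Gamma (1 + ν) /
            (PrudnikovType.DRepl ν n n * PrudnikovType.normSum ν n)))) ∧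
      (∀ n, (P n).coeff 0 ≠ 0) ∧
      -- the three-term recurrence relation and its coefficients
      ∃ A B : ℕ → ℝ,
        (∀ n, A (n + 1) =
          ((P n).coeff 0 * PrudnikovType.D ν (n + 1) * PrudnikovType.DRepl ν n n) /
          ((P (n + 1)).coeff 0 * PrudnikovType.D ν n *
            PrudnikovType.DRepl ν (n + 1) (n + 1))) ∧
        (∀ n, B n = PrudnikovType.DSub ν n / PrudnikovType.DRepl ν n n -
          PrudnikovType.DSub ν (n + 1) / PrudnikovType.DRepl ν (n + 1) (n + 1)) ∧
        X * P 0 = C (A 1) * P 1 + C (B 0) * P 0 ∧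
        (∀ n, X * P (n + 1) =
          C (A (n + 2)) * P (n + 2) + C (B (n + 1)) * P (n + 1) + C (A (n + 1)) * P n) := by
  have hL := PrudnikovType.weightFunctional_mul_self_pos hν
  have hR := PrudnikovType.DRepl_self_ne_zero hν
  have hD := PrudnikovType.D_ne_zero hν
  refine ⟨PrudnikovType.integrableOn_eval_mul_weight hν, ?_,
    fun n => ⟨hD n, hR n, PrudnikovType.DRepl_mul_normSum_pos hν n⟩, fun P hP => ?_⟩
  · refine ⟨_, ⟨PrudnikovType.isOrthonormalSeq_C_mul_detPoly hν, fun n => ?_⟩, ?_⟩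
    · have h1 := PrudnikovType.neg_one_pow_mul_DRepl_neg hν n
      have h2 := PrudnikovType.normFactor_pos hν n
      rw [coeff_C_mul, PrudnikovType.coeff_detPoly, if_pos le_rfl]
      nlinarith
    · rintro P ⟨hP, hpos⟩
      funext n
      rw [hP.eq_C_mul_detPoly hν n, hP.leadingRatio_eq_of_pos hν (hpos n)]
  have ho := hP.weightFunctional_mul hν
  have hlead := PrudnikovType.coeff_ne_zero_of_orthonormal hP.natDegree_eq ho
  have hzero : ∀ n, (P n).coeff 0 =
      -((P n).coeff n / PrudnikovType.DRepl ν n n * PrudnikovType.D ν n) := fun n => by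
    rw [hP.coeff_eq hν n.zero_le, PrudnikovType.DRepl_zero, mul_neg]
  have hzero_ne : ∀ n, (P n).coeff 0 ≠ 0 := fun n => by
    rw [hzero]
    exact neg_ne_zero.2 (mul_ne_zero (div_ne_zero (hlead n) (hR n)) (hD n))
  have hlead_eq : ∀ n, (P n).coeff n =
      -((P n).coeff 0 * (PrudnikovType.DRepl ν n n / PrudnikovType.D ν n)) := fun n => by
    have h1 := hR n
    have h2 := hD n
    rw [hzero]
    field_simp
  have hratio : ∀ n k, k ≤ n → (P n).coeff k / (P n).coeff n =
      PrudnikovType.DRepl ν n k / PrudnikovType.DRepl ν n n := fun n k hk => by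
    have h1 := hR n
    have h2 := hlead n
    rw [hP.coeff_eq hν hk]
    field_simp
  have hA : ∀ n, (P n).coeff n / (P (n + 1)).coeff (n + 1) =
      ((P n).coeff 0 * PrudnikovType.D ν (n + 1) * PrudnikovType.DRepl ν n n) /
      ((P (n + 1)).coeff 0 * PrudnikovType.D ν n *
        PrudnikovType.DRepl ν (n + 1) (n + 1)) := fun n => by
    have h1 := hR (n + 1)
    have h2 := hD n
    have h3 := hD (n + 1)
    have h4 := hzero_ne (n + 1)
    rw [hlead_eq n, hlead_eq (n + 1)]
    field_simp
  refine ⟨fun n k _ hk => ?_, fun n => ?_, fun n hn => ?_, hzero_ne, ?_⟩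
  · have h1 := hR n
    have h2 := hD n
    rw [hP.coeff_eq hν hk, hzero]
    field_simp
  · change _ = _ * PrudnikovType.normFactor ν n ∨ _ = -(_ * PrudnikovType.normFactor ν n)
    rw [hzero]
    rcases hP.leadingRatio_eq hν n with h | h <;> rw [h]
    · exact Or.inr (by ring)
    · exact Or.inl (by ring)
  · change _ = _ * (_ * PrudnikovType.normFactor ν n)
    rw [hzero, hP.leadingRatio_eq_of_pos hν hn]
    ring
  -- `A 0` does not occur in the conclusion, so its value is immaterial.
  · refine ⟨fun n => (P (n - 1)).coeff (n - 1) / (P n).coeff n, fun n =>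
      PrudnikovType.DSub ν n / PrudnikovType.DRepl ν n n -
        PrudnikovType.DSub ν (n + 1) / PrudnikovType.DRepl ν (n + 1) (n + 1),
      fun n => hA n, fun _ => rfl, ?_, fun n => ?_⟩
    · have h := PrudnikovType.first_recurrence hP.natDegree_eq ho
      rw [hratio 1 0 zero_le_one] at h
      simpa [PrudnikovType.DSub] using h
    · have h := PrudnikovType.three_term_recurrence hL hP.natDegree_eq ho n
      rw [hratio (n + 1) n n.le_succ, hratio (n + 2) (n + 1) (n + 1).le_succ] at h
      exact h
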